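/- Let $n\ge 2$ and $b=(b_1,\dots,b_{n-2})\in\mathbb{C}^{n-2}$. Let $e_i=E_{i,i+1}$ and $f_i=E_{i+1,i}$ ($1\le i\le n-1$) be the standard Chevalley generators of the Lie algebra $sl_n$ of trace-zero complex $n\times n$ matrices, where $E_{i,j}$ are the matrix units, and put $b_0=0$, $f_0=0$. Let $sl_n^{(b)}$ be the Lie subalgebra of $sl_n$ generated by the elements $$u_i=e_i+b_{i-1}f_{i-1},\qquad i=1,\dots,n-1 .$$ Then the complex Lie algebra $sl_n^{(b)}$ is presented by the generators $u_1,\dots,u_{n-1}$ and the relations $$[u_i,u_j]=0\quad\text{if } |i-j|>1,\qquad [u_i,[u_i,u_j]]=-2\,b_{\min(i,j)}\,u_i\quad\text{if } |i-j|=1$$ for $i,j\in\{1,\dots,n-1\}$. That is, if $F$ is the free complex Lie algebra on $x_1,\dots,x_{n-1}$ and $I\subset F$ is the Lie ideal generated by all $[x_i,x_j]$ with $|i-j|>1$ and all $[x_i,[x_i,x_j]]+2b_{\min(i,j)}x_i$ with $|i-j|=1$, then $x_i\mapsto u_i$ induces an isomorphism of Lie algebras $F/I\to sl_n^{(b)}$.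 -/

import Mathlib

/- Matrices carry the commutator bracket. -/
attribute [local instance 100] LieRing.ofAssociativeRing

noncomputable section

namespace EdgeElectrical

/-- The Lie algebra `sl_n` of trace-zero complex `n × n` matrices. -/
abbrev slC (n : ℕ) : LieSubalgebra ℂ (Matrix (Fin n) (Fin n) ℂ) :=
  LieAlgebra.SpecialLinear.sl (Fin n) ℂ

/-- The Chevalley generator `e_i = E_{i,i+1}` of `sl_n` for `1 ≤ i ≤ n - 1` (rows and columns
numbered from `1`); by convention it is `0` for every other `i`. -/
def e (n i : ℕ) : slC n :=
  if h : 1 ≤ i ∧ i < n then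
    LieAlgebra.SpecialLinear.single (⟨i - 1, by omega⟩ : Fin n) (⟨i, h.2⟩ : Fin n)
      (by rw [Ne, Fin.mk.injEq]; omega) (1 : ℂ)
  else 0

/-- The Chevalley generator `f_i = E_{i+1,i}` of `sl_n` for `1 ≤ i ≤ n - 1` (rows and columns
numbered from `1`); by convention it is `0` for every other `i`, in particular `f_0 = 0`. -/
def f (n i : ℕ) : slC n :=
  if h : 1 ≤ i ∧ i < n then
    LieAlgebra.SpecialLinear.single (⟨i, h.2⟩ : Fin n) (⟨i - 1, by omega⟩ : Fin n)
      (by rw [Ne, Fin.mk.injEq]; omega) (1 : ℂ)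
  else 0

/-- The `i`-th entry of `b = (b_1, …, b_{n-2})`, numbered from `1`; by convention it is `0` for
every `i` outside `1, …, n - 2`, in particular `b_0 = 0`. -/
def coeff {n : ℕ} (b : Fin (n - 2) → ℂ) (i : ℕ) : ℂ :=
  if h : 1 ≤ i ∧ i ≤ n - 2 then b ⟨i - 1, by omega⟩ else 0

/-- The element `u_i = e_i + b_{i-1} f_{i-1}` of `sl_n`, used for `1 ≤ i ≤ n - 1`. -/
def u {n : ℕ} (b : Fin (n - 2) → ℂ) (i : ℕ) : slC n :=
  e n i + coeff b (i - 1) • f n (i - 1)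

/-- The Lie subalgebra `sl_n^(b)` of `sl_n` generated by `u_1, …, u_{n-1}`. -/
def slb {n : ℕ} (b : Fin (n - 2) → ℂ) : LieSubalgebra ℂ (slC n) :=
  LieSubalgebra.lieSpan ℂ (slC n) {x | ∃ i : ℕ, 1 ≤ i ∧ i ≤ n - 1 ∧ x = u b i}

/-- The index set `{1, …, n - 1}` of the generators. -/
abbrev Idx (n : ℕ) : Type := {i : ℕ // 1 ≤ i ∧ i ≤ n - 1}

/-- `u_i`, as an element of `sl_n^(b)`. -/
def gen {n : ℕ} (b : Fin (n - 2) → ℂ) (i : Idx n) : slb b :=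
  ⟨u b i, LieSubalgebra.subset_lieSpan ⟨i, i.2.1, i.2.2, rfl⟩⟩

/-- The free complex Lie algebra on letters `x_1, …, x_{n-1}`. -/
abbrev Free (n : ℕ) : Type := FreeLieAlgebra ℂ (Idx n)

/-- The letter `x_i`. -/
abbrev x {n : ℕ} (i : Idx n) : Free n := FreeLieAlgebra.of ℂ i

/-- The relators: `[x_i, x_j]` for `|i - j| > 1`, and
`[x_i, [x_i, x_j]] + 2 b_{min(i,j)} x_i` for `|i - j| = 1`. -/
def relators {n : ℕ} (b : Fin (n - 2) → ℂ) : Set (Free n) :=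
  {r | ∃ i j : Idx n, 1 < |(i.1 : ℤ) - (j.1 : ℤ)| ∧ r = ⁅x i, x j⁆} ∪
  {r | ∃ i j : Idx n, |(i.1 : ℤ) - (j.1 : ℤ)| = 1 ∧
    r = ⁅x i, ⁅x i, x j⁆⁆ - (-2 * coeff b (min i.1 j.1)) • x i}

/-- The Lie ideal of the free Lie algebra generated by the relators. -/
abbrev relIdeal {n : ℕ} (b : Fin (n - 2) → ℂ) : LieIdeal ℂ (Free n) :=
  LieSubmodule.lieSpan ℂ (Free n) (relators b)

/-- The Lie algebra presented by the generators `x_1, …, x_{n-1}` and the relators. -/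
abbrev Presented {n : ℕ} (b : Fin (n - 2) → ℂ) : Type := Free n ⧸ relIdeal b

/-- The class of `x_i` in the presented Lie algebra. -/
abbrev letter {n : ℕ} (b : Fin (n - 2) → ℂ) (i : Idx n) : Presented b :=
  LieSubmodule.Quotient.mk (x i)

end EdgeElectrical

end

/-! The presented algebra is bounded above by a spanning set whose image in `sl_n` is independent.
Write `chain y i l` for the right-nested bracket of `y i, …, y (i + l)`. The relations alone make
the span of all chains stable under `ad (y k)`, so chains span any Lie algebra generated by such `y`
(`chainSpan_eq_top`); the delicate case is bracketing with the second letter (`lie_middle`). In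
matrices, the chain from `i` with `l + 1` letters has a single 1 on the superdiagonal `l + 1`, in
row `i`, and zeros above it; the `b`-terms only contribute lower down. These leading positions are
distinct, so the images of the spanning chains are independent and the map is injective. -/

namespace EdgeElectrical

/-! ### Brackets of chains under the deformed Serre relations -/

section Chain

variable {K L L' : Type*} [Field K] [LieRing L] [LieAlgebra K L] [LieRing L'] [LieAlgebra K L']

/-- The iterated bracket `[y_i, [y_{i+1}, […, y_{i+l}]]]`. -/
def chain (y : ℕ → L) : ℕ → ℕ → L
  | i, 0 => y i
  | i, l + 1 => ⁅y i, chain y (i + 1) l⁆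

@[simp] lemma chain_zero (y : ℕ → L) (i : ℕ) : chain y i 0 = y i := rfl

lemma chain_succ (y : ℕ → L) (i l : ℕ) : chain y i (l + 1) = ⁅y i, chain y (i + 1) l⁆ := rfl

lemma map_chain (g : L →ₗ⁅K⁆ L') (y : ℕ → L) (i l : ℕ) :
    g (chain y i l) = chain (fun k => g (y k)) i l := by
  induction l generalizing i with
  | zero => rfl
  | succ l ih => simp [chain_succ, ih]

lemma chain_eq_zero_of_head {y : ℕ → L} {i : ℕ} (h : y i = 0) (l : ℕ) : chain y i l = 0 := by
  cases l with
  | zero => exact h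
  | succ l => simp [chain_succ, h]

lemma chain_eq_zero_of_last {y : ℕ → L} {i l : ℕ} (h : y (i + l) = 0) : chain y i l = 0 := by
  induction l generalizing i with
  | zero => exact h
  | succ l ih => rw [chain_succ, ih (by rwa [add_assoc, add_comm 1 l]), lie_zero]

/-- The deformed Serre relations of type `A` with parameters `c`. -/
structure SerreRelations (y : ℕ → L) (c : ℕ → K) : Prop where
  far : ∀ i j, i + 2 ≤ j → ⁅y i, y j⁆ = 0
  up : ∀ i, ⁅y i, ⁅y i, y (i + 1)⁆⁆ = (-2 * c i) • y i
  down : ∀ i, ⁅y (i + 1), ⁅y (i + 1), y i⁆⁆ = (-2 * c i) • y (i + 1)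

/-- The span of the chains that start at `i` or later. -/
def chainSpan (K : Type*) [Field K] {L : Type*} [LieRing L] [LieAlgebra K L] (y : ℕ → L) (i : ℕ) :
    Submodule K L :=
  Submodule.span K {a | ∃ p l, i ≤ p ∧ a = chain y p l}

lemma chain_mem_chainSpan (y : ℕ → L) {i p : ℕ} (h : i ≤ p) (l : ℕ) :
    chain y p l ∈ chainSpan K y i :=
  Submodule.subset_span ⟨p, l, h, rfl⟩

lemma gen_mem_chainSpan (y : ℕ → L) {i p : ℕ} (h : i ≤ p) : y p ∈ chainSpan K y i :=
  chain_mem_chainSpan y h 0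

lemma lie_mem_of_mem_chainSpan {y : ℕ → L} {i : ℕ} {S : Submodule K L} {z : L}
    (h : ∀ p l, i ≤ p → ⁅z, chain y p l⁆ ∈ S) {a : L} (ha : a ∈ chainSpan K y i) : ⁅z, a⁆ ∈ S := by
  induction ha using Submodule.span_induction with
  | mem a ha =>
    obtain ⟨p, l, hp, rfl⟩ := ha
    exact h p l hp
  | zero => simp
  | add a a' _ _ h h' => rw [lie_add]; exact S.add_mem h h'
  | smul t a _ h => rw [lie_smul]; exact S.smul_mem t h

namespace SerreRelations

variable {y : ℕ → L} {c : ℕ → K} (hy : SerreRelations y c)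
include hy

lemma lie_chain_far {k i : ℕ} (h : k + 2 ≤ i) (l : ℕ) : ⁅y k, chain y i l⁆ = 0 := by
  induction l generalizing i with
  | zero => exact hy.far k i h
  | succ l ih => rw [chain_succ, leibniz_lie, hy.far k i h, ih (by omega), zero_lie, lie_zero,
      add_zero]

lemma far' {i j : ℕ} (h : j + 2 ≤ i) : ⁅y i, y j⁆ = 0 := by
  rw [← lie_skew, hy.far j i h, neg_zero]

/-- A chain of length at least three has its first two letters bracketed together. -/
lemma chain_add_two (i l : ℕ) :
    chain y i (l + 2) = ⁅⁅y i, y (i + 1)⁆, chain y (i + 2) l⁆ := by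
  rw [chain_succ, chain_succ, leibniz_lie, hy.lie_chain_far le_rfl, lie_zero, add_zero]

lemma lie_head_chain_mem (i l : ℕ) : ⁅y i, chain y i l⁆ ∈ chainSpan K y i := by
  match l with
  | 0 => simp
  | 1 =>
    rw [chain_succ, chain_zero, hy.up]
    exact Submodule.smul_mem _ _ (gen_mem_chainSpan y le_rfl)
  | l + 2 =>
    rw [hy.chain_add_two, leibniz_lie, hy.up, smul_lie, hy.lie_chain_far le_rfl, lie_zero,
      smul_zero, zero_add]
    exact Submodule.zero_mem _

lemma lie_head_mem {i : ℕ} {a : L} (ha : a ∈ chainSpan K y (i + 1)) :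
    ⁅y i, a⁆ ∈ chainSpan K y i := by
  refine lie_mem_of_mem_chainSpan (fun p l hp => ?_) ha
  obtain rfl | hp := hp.eq_or_lt
  · exact chain_mem_chainSpan y le_rfl (l + 1)
  · rw [hy.lie_chain_far (by omega)]
    exact Submodule.zero_mem _

/-- The bracket of the middle letter with a chain of three letters. -/
lemma lie_middle [NeZero (2 : K)] (i : ℕ) :
    ⁅y (i + 1), ⁅⁅y i, y (i + 1)⁆, y (i + 2)⁆⁆ =
      c i • ⁅y (i + 1), y (i + 2)⁆ - c (i + 1) • ⁅y i, y (i + 1)⁆ := by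
  have h2 : (2 : K) ≠ 0 := NeZero.ne 2
  have hassoc : ⁅⁅y i, y (i + 1)⁆, y (i + 2)⁆ = ⁅y i, ⁅y (i + 1), y (i + 2)⁆⁆ := by
    rw [leibniz_lie (y i), hy.far i (i + 2) le_rfl, lie_zero, add_zero]
  have hneg : ⁅y (i + 1), y i⁆ = -⁅y i, y (i + 1)⁆ := (lie_skew _ _).symm
  -- The two bracketings of the three letters, expanded by Leibniz, produce the same unknown term
  -- with opposite signs. Adding them eliminates it and leaves a factor 2 to cancel.
  have hfst : ⁅y (i + 1), ⁅⁅y i, y (i + 1)⁆, y (i + 2)⁆⁆ =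
      (2 * c i) • ⁅y (i + 1), y (i + 2)⁆ + ⁅⁅y i, y (i + 1)⁆, ⁅y (i + 1), y (i + 2)⁆⁆ := by
    have hd := hy.down i
    rw [hneg, lie_neg, neg_eq_iff_eq_neg] at hd
    rw [leibniz_lie, hd, ← neg_smul, smul_lie, neg_mul, neg_neg]
  have hsnd : ⁅y (i + 1), ⁅⁅y i, y (i + 1)⁆, y (i + 2)⁆⁆ =
      -⁅⁅y i, y (i + 1)⁆, ⁅y (i + 1), y (i + 2)⁆⁆ - (2 * c (i + 1)) • ⁅y i, y (i + 1)⁆ := by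
    rw [hassoc, leibniz_lie, hneg, neg_lie, hy.up (i + 1), lie_smul, neg_mul, neg_smul,
      sub_eq_add_neg]
  refine smul_right_injective L h2 ?_
  change (2 : K) • _ = (2 : K) • _
  rw [two_smul]
  nth_rewrite 1 [hfst]
  rw [hsnd]
  module

lemma lie_second_chain_mem [NeZero (2 : K)] (i l : ℕ) :
    ⁅y (i + 1), chain y i l⁆ ∈ chainSpan K y i := by
  match l with
  | 0 =>
    rw [chain_zero, ← lie_skew]
    exact Submodule.neg_mem _ (chain_mem_chainSpan y le_rfl 1)
  | 1 =>
    rw [chain_succ, chain_zero, ← lie_skew (y i), lie_neg, hy.down]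
    exact Submodule.neg_mem _ (Submodule.smul_mem _ _ (gen_mem_chainSpan y (by omega)))
  | 2 =>
    rw [hy.chain_add_two, chain_zero, hy.lie_middle]
    exact Submodule.sub_mem _
      (Submodule.smul_mem _ _ (chain_mem_chainSpan y (Nat.le_succ i) 1))
      (Submodule.smul_mem _ _ (chain_mem_chainSpan y le_rfl 1))
  | l + 3 =>
    -- The tail from `i + 3` commutes with `y i` and `y (i + 1)`, so `lie_middle` on the first three
    -- letters decides the case.
    have h0 := hy.lie_chain_far (k := i) (i := i + 3) (by omega) l
    have h1 := hy.lie_chain_far (k := i + 1) (i := i + 3) (by omega) l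
    have h01 : ⁅⁅y i, y (i + 1)⁆, chain y (i + 3) l⁆ = 0 := by
      rw [lie_lie, h0, h1, lie_zero, lie_zero, sub_zero]
    have hT : chain y i (l + 3) = ⁅⁅⁅y i, y (i + 1)⁆, y (i + 2)⁆, chain y (i + 3) l⁆ := by
      rw [hy.chain_add_two, chain_succ, leibniz_lie, h01, lie_zero, add_zero]
    rw [hT, leibniz_lie, h1, lie_zero, add_zero, hy.lie_middle, sub_lie, smul_lie, smul_lie, h01,
      smul_zero, sub_zero, ← hy.chain_add_two]
    exact Submodule.smul_mem _ _ (chain_mem_chainSpan y (Nat.le_succ i) _)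

/-- `y k` commutes past the leading letters until it is the second letter of the remaining tail, or
the chain runs out. -/
lemma lie_later_chain_mem [NeZero (2 : K)] {k i : ℕ} (h : i < k) (l : ℕ) :
    ⁅y k, chain y i l⁆ ∈ chainSpan K y i := by
  obtain rfl | h := (Nat.succ_le_of_lt h).eq_or_lt
  · exact hy.lie_second_chain_mem i l
  induction l generalizing i with
  | zero => rw [chain_zero, hy.far' (by omega)]; exact Submodule.zero_mem _
  | succ l ih =>
    rw [chain_succ, leibniz_lie, hy.far' (by omega), zero_lie, zero_add]
    refine hy.lie_head_mem ?_
    obtain rfl | h' := (Nat.succ_le_of_lt h).eq_or_lt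
    · exact hy.lie_second_chain_mem (i + 1) l
    · exact ih (by omega) h'

lemma lie_chain_mem [NeZero (2 : K)] (k i l : ℕ) : ⁅y k, chain y i l⁆ ∈ chainSpan K y 0 := by
  have mono : ∀ j, chainSpan K y j ≤ chainSpan K y 0 := fun j =>
    Submodule.span_mono fun a ⟨p, l, _, ha⟩ => ⟨p, l, Nat.zero_le p, ha⟩
  rcases lt_trichotomy k i with h | rfl | h
  · exact mono k (hy.lie_head_mem (chain_mem_chainSpan y h l))
  · exact mono k (hy.lie_head_chain_mem k l)
  · exact mono i (hy.lie_later_chain_mem h l)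

/-- A Lie algebra generated by elements satisfying the relations is spanned by the chains. -/
theorem chainSpan_eq_top [NeZero (2 : K)] (hgen : LieSubalgebra.lieSpan K L (Set.range y) = ⊤) :
    chainSpan K y 0 = ⊤ := by
  -- By Jacobi, the `z` that preserve the span form a Lie subalgebra, so generators suffice.
  have stable : ∀ z s : L, s ∈ chainSpan K y 0 → ⁅z, s⁆ ∈ chainSpan K y 0 := by
    intro z
    have hz : z ∈ LieSubalgebra.lieSpan K L (Set.range y) := hgen ▸ LieSubalgebra.mem_top z
    induction hz using LieSubalgebra.lieSpan_induction with
    | mem z hz =>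
      obtain ⟨k, rfl⟩ := hz
      exact fun s hs => lie_mem_of_mem_chainSpan (fun p l _ => hy.lie_chain_mem k p l) hs
    | zero => simp
    | add z z' _ _ h h' =>
      exact fun s hs => by rw [add_lie]; exact Submodule.add_mem _ (h s hs) (h' s hs)
    | smul t z _ h => exact fun s hs => by rw [smul_lie]; exact Submodule.smul_mem _ _ (h s hs)
    | lie z z' _ _ h h' =>
      exact fun s hs => by
        rw [lie_lie]; exact Submodule.sub_mem _ (h _ (h' s hs)) (h' _ (h s hs))
  refine eq_top_iff.2 fun z _ => ?_
  have hz : z ∈ LieSubalgebra.lieSpan K L (Set.range y) := hgen ▸ LieSubalgebra.mem_top z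
  induction hz using LieSubalgebra.lieSpan_induction with
  | mem z hz =>
    obtain ⟨k, rfl⟩ := hz
    exact gen_mem_chainSpan y (Nat.zero_le k)
  | zero => exact Submodule.zero_mem _
  | add z z' _ _ h h' => exact Submodule.add_mem _ (h trivial) (h' trivial)
  | smul t z _ h => exact Submodule.smul_mem _ _ (h trivial)
  | lie z z' _ _ _ h' => exact stable _ _ (h' trivial)

end SerreRelations

end Chain

/-! ### Leading superdiagonals and linear independence -/

section Independence

/-- The index set of the chains of letters among `1, …, n - 1`. -/
abbrev ChainIdx (n : ℕ) : Type := {q : ℕ × ℕ // 1 ≤ q.1 ∧ q.1 + q.2 < n}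

variable {n : ℕ} {R : Type*} [CommRing R]

/-- `M` vanishes above the `d`-th superdiagonal and has a single entry `1` on it, in the row
numbered `i` from `1`. -/
def HasLeadingUnit (M : Matrix (Fin n) (Fin n) R) (i d : ℕ) : Prop :=
  (∀ p q : Fin n, p.1 + d < q.1 → M p q = 0) ∧
    ∀ p q : Fin n, q.1 = p.1 + d → M p q = if p.1 + 1 = i then 1 else 0

lemma HasLeadingUnit.lie {A B : Matrix (Fin n) (Fin n) R} {i d : ℕ}
    (hA : HasLeadingUnit A i 1) (hB : HasLeadingUnit B (i + 1) (d + 1)) :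
    HasLeadingUnit ⁅A, B⁆ i (d + 2) := by
  have hAB : ∀ p q : Fin n, p.1 + (d + 2) ≤ q.1 →
      (A * B) p q = if p.1 + 1 = i ∧ q.1 = p.1 + (d + 2) then 1 else 0 := by
    intro p q hpq
    rw [Matrix.mul_apply, Finset.sum_eq_single (⟨p.1 + 1, by omega⟩ : Fin n)]
    · rw [hA.2 p _ rfl]
      split_ifs with h1 h2 h2
      · rw [hB.2 _ q (by simp only; omega), if_pos (by simp only; omega), one_mul]
      · rw [hB.1 _ q (by simp only; omega), mul_zero]
      · omega
      · rw [zero_mul]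
    · intro r _ hr
      have hr' : r.1 ≠ p.1 + 1 := fun h => hr (Fin.ext h)
      by_cases h : p.1 + 1 < r.1
      · rw [hA.1 p r h, zero_mul]
      · rw [hB.1 r q (by omega), mul_zero]
    · simp
  have hBA : ∀ p q : Fin n, p.1 + (d + 2) ≤ q.1 → (B * A) p q = 0 := by
    intro p q hpq
    rw [Matrix.mul_apply]
    refine Finset.sum_eq_zero fun r _ => ?_
    by_cases h : p.1 + (d + 1) < r.1
    · rw [hB.1 p r h, zero_mul]
    by_cases h' : r.1 + 1 < q.1
    · rw [hA.1 r q h', mul_zero]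
    rw [hB.2 p r (by omega), hA.2 r q (by omega)]
    split_ifs <;> first | omega | simp
  constructor
  · intro p q h
    rw [Ring.lie_def, Matrix.sub_apply, hAB p q h.le, hBA p q h.le, if_neg (by omega), sub_zero]
  · intro p q h
    rw [Ring.lie_def, Matrix.sub_apply, hAB p q h.ge, hBA p q h.ge, sub_zero]
    simp [h]

lemma hasLeadingUnit_chain {U : ℕ → Matrix (Fin n) (Fin n) R}
    (hU : ∀ i, HasLeadingUnit (U i) i 1) (i l : ℕ) : HasLeadingUnit (chain U i l) i (l + 1) := by
  induction l generalizing i with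
  | zero => exact hU i
  | succ l ih => exact (hU i).lie (ih (i + 1))

lemma linearIndependent_of_hasLeadingUnit {M : ChainIdx n → Matrix (Fin n) (Fin n) R}
    (hM : ∀ q, HasLeadingUnit (M q) q.1.1 (q.1.2 + 1)) : LinearIndependent R M := by
  rw [linearIndependent_iff]
  intro t ht
  by_contra hne
  obtain ⟨q, hq, hmax⟩ := t.support.exists_max_image (fun q => q.1.2)
    (Finsupp.support_nonempty_iff.2 hne)
  refine Finsupp.mem_support_iff.1 hq ?_
  obtain ⟨⟨i, l⟩, hi, hl⟩ := q
  -- At the leading position of a longest chain in the support, every other term vanishes.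
  simp only at hi hl hmax
  have hent := congrFun (congrFun ht ⟨i - 1, by omega⟩) ⟨i + l, hl⟩
  rw [Finsupp.linearCombination_apply, Finsupp.sum, Matrix.sum_apply,
    Finset.sum_eq_single ⟨(i, l), hi, hl⟩] at hent
  · rw [Matrix.smul_apply, (hM _).2 _ _ (by simp only; omega), if_pos (by simp only; omega)] at hent
    simpa using hent
  · intro r hr hne'
    have hrl := hmax r hr
    rw [Matrix.smul_apply]
    obtain hlt | heq := hrl.lt_or_eq
    · rw [(hM r).1 _ _ (by simp only; omega), smul_zero]
    · rw [(hM r).2 _ _ (by simp only; omega), if_neg, smul_zero]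
      intro h
      exact hne' (Subtype.ext (Prod.ext (by simp only at h ⊢; omega) heq))
  · exact fun h => absurd hq h

lemma injective_of_span_eq_top_of_linearIndependent {ι M M' : Type*} [AddCommGroup M] [Module R M]
    [AddCommGroup M'] [Module R M'] (g : M →ₗ[R] M') (v : ι → M)
    (hv : Submodule.span R (Set.range v) = ⊤) (hg : LinearIndependent R (g ∘ v)) :
    Function.Injective g := by
  rw [injective_iff_map_eq_zero]
  intro a ha
  obtain ⟨t, rfl⟩ := (Finsupp.mem_span_range_iff_exists_finsupp (v := v)).1
    (hv ▸ Submodule.mem_top : a ∈ _)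
  rw [← Finsupp.linearCombination_apply] at ha ⊢
  rw [Finsupp.apply_linearCombination] at ha
  rw [linearIndependent_iff.1 hg t ha, map_zero]

end Independence

/-! ### The matrices `u_i` -/

section Matrices

variable {n : ℕ} (b : Fin (n - 2) → ℂ)

/-- The column factor of the rank one matrix `u_i`. -/
def colVec (n i : ℕ) : Fin n → ℂ := fun p => if p.1 + 1 = i then 1 else 0

/-- The row factor of the rank one matrix `u_i`. -/
def rowVec (i : ℕ) : Fin n → ℂ := fun q =>
  (if q.1 = i then 1 else 0) + coeff b (i - 1) * if q.1 + 2 = i then 1 else 0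

lemma coeff_eq_zero {i : ℕ} (h : n ≤ i + 1) : coeff b i = 0 := dif_neg (by omega)

lemma e_apply (i : ℕ) (p q : Fin n) :
    (e n i).1 p q = if p.1 + 1 = i ∧ q.1 = i then 1 else 0 := by
  unfold e
  split_ifs with h1 h2 h2
  · rw [LieAlgebra.SpecialLinear.val_single, Matrix.single_apply, if_pos]
    simp only [Fin.ext_iff]; omega
  · rw [LieAlgebra.SpecialLinear.val_single, Matrix.single_apply, if_neg]
    simp only [Fin.ext_iff]; omega
  · omega
  · rfl

lemma f_apply (i : ℕ) (p q : Fin n) :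
    (f n i).1 p q = if p.1 = i ∧ q.1 + 1 = i then 1 else 0 := by
  unfold f
  split_ifs with h1 h2 h2
  · rw [LieAlgebra.SpecialLinear.val_single, Matrix.single_apply, if_pos]
    simp only [Fin.ext_iff]; omega
  · rw [LieAlgebra.SpecialLinear.val_single, Matrix.single_apply, if_neg]
    simp only [Fin.ext_iff]; omega
  · omega
  · rfl

/-- Both `e_i` and `f_{i-1}` live in row `i`, hence rank one; brackets then reduce to dot products.
-/
lemma val_u (i : ℕ) : (u b i).1 = Matrix.vecMulVec (colVec n i) (rowVec b i) := by
  ext p q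
  have hsum : (u b i).1 p q = (e n i).1 p q + coeff b (i - 1) * (f n (i - 1)).1 p q := rfl
  rw [hsum, e_apply, f_apply, Matrix.vecMulVec_apply, colVec, rowVec]
  by_cases hp : p.1 + 1 = i
  · have h : (p.1 = i - 1 ∧ q.1 + 1 = i - 1) ↔ q.1 + 2 = i := by omega
    simp [hp, h]
  · have h : ¬(p.1 = i - 1 ∧ q.1 + 1 = i - 1) := by omega
    simp [hp, h]

lemma u_eq_zero {i : ℕ} (h : ¬(1 ≤ i ∧ i ≤ n - 1)) : u b i = 0 := by
  apply Subtype.ext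
  rw [val_u]
  obtain hi | hi : i = 0 ∨ n ≤ i := by omega
  · have : colVec n i = 0 := funext fun p => if_neg (by omega)
    simp [this]
  · have : rowVec b i = 0 := funext fun q => by
      simp only [rowVec, Pi.zero_apply]
      rw [if_neg (by omega), coeff_eq_zero b (by omega), zero_mul, add_zero]
    simp [this]

lemma rowVec_dotProduct_colVec (i : ℕ) {j : ℕ} (hj : 1 ≤ j ∧ j ≤ n - 1) :
    rowVec b i ⬝ᵥ colVec n j =
      (if j = i + 1 then 1 else 0) + coeff b (i - 1) * if j + 1 = i then 1 else 0 := by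
  have hc : colVec n j = Pi.single (⟨j - 1, by omega⟩ : Fin n) 1 := by
    ext p
    simp only [colVec, Pi.single_apply, Fin.ext_iff]
    congr 1
    simp only [eq_iff_iff]
    omega
  rw [hc, dotProduct_single, mul_one]
  have h1 : j - 1 = i ↔ j = i + 1 := by omega
  have h2 : j - 1 + 2 = i ↔ j + 1 = i := by omega
  simp only [rowVec, h1, h2]

lemma lie_vecMulVec {m : Type*} [Fintype m] [DecidableEq m] (v w v' w' : m → ℂ) :
    ⁅Matrix.vecMulVec v w, Matrix.vecMulVec v' w'⁆ =
      (w ⬝ᵥ v') • Matrix.vecMulVec v w' - (w' ⬝ᵥ v) • Matrix.vecMulVec v' w := by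
  simp [Ring.lie_def, Matrix.vecMulVec_mul_vecMulVec]

/-- For `X` of square zero, `[X, [X, Y]] = -2 X Y X`, and a rank one `X` makes `X Y X` a multiple of
`X`. -/
lemma lie_lie_vecMulVec {m : Type*} [Fintype m] [DecidableEq m] (v w v' w' : m → ℂ)
    (h : w ⬝ᵥ v = 0) :
    ⁅Matrix.vecMulVec v w, ⁅Matrix.vecMulVec v w, Matrix.vecMulVec v' w'⁆⁆ =
      (-2 * ((w ⬝ᵥ v') * (w' ⬝ᵥ v))) • Matrix.vecMulVec v w := by
  rw [lie_vecMulVec, lie_sub, lie_smul, lie_smul, lie_vecMulVec, lie_vecMulVec, h]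
  module

lemma lie_u_of_far {i j : ℕ} (hi : 1 ≤ i ∧ i ≤ n - 1) (hj : 1 ≤ j ∧ j ≤ n - 1)
    (h : i + 1 < j ∨ j + 1 < i) : ⁅u b i, u b j⁆ = 0 := by
  apply Subtype.ext
  rw [LieSubalgebra.coe_bracket, val_u, val_u, lie_vecMulVec, rowVec_dotProduct_colVec b i hj,
    rowVec_dotProduct_colVec b j hi, if_neg (by omega), if_neg (by omega), if_neg (by omega),
    if_neg (by omega)]
  simp

lemma lie_lie_u_of_adjacent {i j : ℕ} (hi : 1 ≤ i ∧ i ≤ n - 1) (hj : 1 ≤ j ∧ j ≤ n - 1)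
    (h : j = i + 1 ∨ i = j + 1) :
    ⁅u b i, ⁅u b i, u b j⁆⁆ = (-2 * coeff b (min i j)) • u b i := by
  apply Subtype.ext
  change ⁅(u b i).1, ⁅(u b i).1, (u b j).1⁆⁆ = (-2 * coeff b (min i j)) • (u b i).1
  rw [val_u, val_u,
    lie_lie_vecMulVec, rowVec_dotProduct_colVec b i hj, rowVec_dotProduct_colVec b j hi]
  · obtain rfl | rfl := h <;> simp [add_assoc]
  · rw [rowVec_dotProduct_colVec b i hi]
    simp

lemma hasLeadingUnit_u (i : ℕ) : HasLeadingUnit (u b i).1 i 1 := by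
  rw [val_u]
  constructor
  · intro p q h
    rw [Matrix.vecMulVec_apply, colVec, rowVec]
    split_ifs <;> first | omega | simp
  · intro p q h
    rw [Matrix.vecMulVec_apply, colVec, rowVec]
    split_ifs <;> first | omega | simp

end Matrices

/-! ### The presented algebra and its map to `slb b` -/

section Presentation

variable {n : ℕ} (b : Fin (n - 2) → ℂ)

/-- The homomorphism from the free Lie algebra that sends `x_i` to `u_i`. -/
noncomputable def freeHom : Free n →ₗ⁅ℂ⁆ slb b := FreeLieAlgebra.lift ℂ (gen b)

lemma relIdeal_le_ker : relIdeal b ≤ (freeHom b).ker := by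
  rw [LieSubmodule.lieSpan_le]
  rintro r (⟨i, j, h, rfl⟩ | ⟨i, j, h, rfl⟩)
  · have h' : i.1 + 1 < j.1 ∨ j.1 + 1 < i.1 := by
      rcases lt_abs.1 h with h | h <;> omega
    rw [SetLike.mem_coe, LieHom.mem_ker, LieHom.map_lie, freeHom, FreeLieAlgebra.lift_of_apply,
      FreeLieAlgebra.lift_of_apply]
    exact Subtype.ext (lie_u_of_far b i.2 j.2 h')
  · have h' : j.1 = i.1 + 1 ∨ i.1 = j.1 + 1 := by
      rcases (abs_eq zero_le_one).1 h with h | h <;> omega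
    rw [SetLike.mem_coe, LieHom.mem_ker, map_sub, map_smul, LieHom.map_lie,
      LieHom.map_lie, freeHom, FreeLieAlgebra.lift_of_apply, FreeLieAlgebra.lift_of_apply,
      sub_eq_zero]
    exact Subtype.ext (lie_lie_u_of_adjacent b i.2 j.2 h')

/-- The homomorphism from the presented Lie algebra induced by `x_i ↦ u_i`. -/
noncomputable def presentedHom : Presented b →ₗ⁅ℂ⁆ slb b where
  toLinearMap := (relIdeal b).toSubmodule.liftQ (freeHom b : Free n →ₗ[ℂ] slb b)
    fun _ ha => relIdeal_le_ker b ha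
  map_lie' := by
    intro a a'
    induction a using Submodule.Quotient.induction_on
    induction a' using Submodule.Quotient.induction_on
    exact (freeHom b).map_lie _ _

lemma presentedHom_mk (a : Free n) :
    presentedHom b (LieSubmodule.Quotient.mk a) = freeHom b a := rfl

lemma presentedHom_letter (i : Idx n) : presentedHom b (letter b i) = gen b i := by
  rw [presentedHom_mk, freeHom, FreeLieAlgebra.lift_of_apply]

/-- The letters of the presented Lie algebra, extended by `0` to all indices. -/
noncomputable def letterNat (i : ℕ) : Presented b := if h : 1 ≤ i ∧ i ≤ n - 1 then letter b ⟨i, h⟩ else 0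

lemma letterNat_of_mem (i : Idx n) : letterNat b i.1 = letter b i := dif_pos i.2

lemma letterNat_of_not_mem {i : ℕ} (h : ¬(1 ≤ i ∧ i ≤ n - 1)) : letterNat b i = 0 := dif_neg h

lemma val_presentedHom_letterNat (i : ℕ) : (presentedHom b (letterNat b i)).1 = u b i := by
  by_cases h : 1 ≤ i ∧ i ≤ n - 1
  · rw [letterNat_of_mem b ⟨i, h⟩, presentedHom_letter]
    rfl
  · rw [letterNat_of_not_mem b h, u_eq_zero b h, map_zero]
    rfl

lemma lie_letter_of_far (i j : Idx n) (h : 1 < |(i.1 : ℤ) - (j.1 : ℤ)|) :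
    ⁅letter b i, letter b j⁆ = 0 := by
  rw [← LieSubmodule.Quotient.mk_bracket, LieSubmodule.Quotient.mk_eq_zero']
  exact LieSubmodule.subset_lieSpan (Or.inl ⟨i, j, h, rfl⟩)

lemma lie_lie_letter_of_adjacent (i j : Idx n) (h : |(i.1 : ℤ) - (j.1 : ℤ)| = 1) :
    ⁅letter b i, ⁅letter b i, letter b j⁆⁆ = (-2 * coeff b (min i.1 j.1)) • letter b i := by
  refine (Submodule.Quotient.eq (relIdeal b).toSubmodule).2 ?_
  exact LieSubmodule.subset_lieSpan (Or.inr ⟨i, j, h, rfl⟩)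

/-- Extension by zero is harmless at the two ends because `b_0` and `b_{n-1}` are zero by
convention. -/
lemma serreRelations_letterNat : SerreRelations (letterNat b) (coeff b) where
  far i j h := by
    by_cases hi : 1 ≤ i ∧ i ≤ n - 1
    · by_cases hj : 1 ≤ j ∧ j ≤ n - 1
      · rw [letterNat_of_mem b ⟨i, hi⟩, letterNat_of_mem b ⟨j, hj⟩]
        exact lie_letter_of_far b _ _ (lt_abs.2 (Or.inr (by simp only; omega)))
      · rw [letterNat_of_not_mem b hj, lie_zero]
    · rw [letterNat_of_not_mem b hi, zero_lie]
  up i := by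
    by_cases hi : 1 ≤ i ∧ i ≤ n - 1
    · by_cases hj : 1 ≤ i + 1 ∧ i + 1 ≤ n - 1
      · rw [letterNat_of_mem b ⟨i, hi⟩, letterNat_of_mem b ⟨i + 1, hj⟩,
          lie_lie_letter_of_adjacent b _ _ (by simp)]
        simp
      · rw [letterNat_of_not_mem b hj, coeff_eq_zero b (by omega)]
        simp
    · simp [letterNat_of_not_mem b hi]
  down i := by
    by_cases hj : 1 ≤ i + 1 ∧ i + 1 ≤ n - 1
    · by_cases hi : 1 ≤ i ∧ i ≤ n - 1
      · rw [letterNat_of_mem b ⟨i, hi⟩, letterNat_of_mem b ⟨i + 1, hj⟩,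
          lie_lie_letter_of_adjacent b _ _ (by simp)]
        simp
      · have hc : coeff b i = 0 := dif_neg (by omega)
        rw [letterNat_of_not_mem b hi, hc]
        simp
    · simp [letterNat_of_not_mem b hj]

/-- The universal property gives a map into the generated subalgebra whose composite with the
inclusion is the identity. -/
lemma lieSpan_range_of (R X : Type*) [CommRing R] :
    LieSubalgebra.lieSpan R (FreeLieAlgebra R X) (Set.range (FreeLieAlgebra.of R)) = ⊤ := by
  set S := LieSubalgebra.lieSpan R (FreeLieAlgebra R X) (Set.range (FreeLieAlgebra.of R))
  let g : FreeLieAlgebra R X →ₗ⁅R⁆ S := FreeLieAlgebra.lift R fun a =>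
    ⟨FreeLieAlgebra.of R a, LieSubalgebra.subset_lieSpan ⟨a, rfl⟩⟩
  have hg : S.incl.comp g = LieHom.id := FreeLieAlgebra.hom_ext fun a => by simp [g]
  refine eq_top_iff.2 fun a _ => ?_
  have ha : (g a).1 = a := LieHom.congr_fun hg a
  exact ha ▸ (g a).2

lemma lieSpan_range_letterNat :
    LieSubalgebra.lieSpan ℂ (Presented b) (Set.range (letterNat b)) = ⊤ := by
  refine eq_top_iff.2 fun a _ => ?_
  induction a using Submodule.Quotient.induction_on with | _ a
  have ha : a ∈ LieSubalgebra.lieSpan ℂ (Free n) (Set.range (FreeLieAlgebra.of ℂ)) :=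
    lieSpan_range_of ℂ (Idx n) ▸ LieSubalgebra.mem_top a
  induction ha using LieSubalgebra.lieSpan_induction with
  | mem a ha =>
    obtain ⟨i, rfl⟩ := ha
    exact LieSubalgebra.subset_lieSpan ⟨i.1, letterNat_of_mem b i⟩
  | zero => exact LieSubalgebra.zero_mem _
  | add a a' _ _ h h' => exact LieSubalgebra.add_mem _ (h trivial) (h' trivial)
  | smul t a _ h => exact LieSubalgebra.smul_mem _ t (h trivial)
  | lie a a' _ _ h h' => exact LieSubalgebra.lie_mem _ (h trivial) (h' trivial)

lemma span_chain_letterNat :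
    Submodule.span ℂ (Set.range fun q : ChainIdx n => chain (letterNat b) q.1.1 q.1.2) = ⊤ := by
  rw [eq_top_iff, ← (serreRelations_letterNat b).chainSpan_eq_top (lieSpan_range_letterNat b),
    chainSpan, Submodule.span_le]
  rintro a ⟨i, l, -, rfl⟩
  by_cases h : 1 ≤ i ∧ i + l < n
  · exact Submodule.subset_span ⟨⟨(i, l), h⟩, rfl⟩
  · have h0 : chain (letterNat b) i l = 0 := by
      by_cases hi : 1 ≤ i
      · exact chain_eq_zero_of_last (letterNat_of_not_mem b (by omega))
      · exact chain_eq_zero_of_head (letterNat_of_not_mem b (by omega)) l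
    rw [h0]
    exact Submodule.zero_mem _

lemma presentedHom_injective : Function.Injective (presentedHom b) := by
  let g : Presented b →ₗ⁅ℂ⁆ Matrix (Fin n) (Fin n) ℂ :=
    ((slC n).incl.comp (slb b).incl).comp (presentedHom b)
  have hg : ∀ i, g (letterNat b i) = (u b i).1 := fun i =>
    congrArg Subtype.val (val_presentedHom_letterNat b i)
  have hinj : Function.Injective g :=
    injective_of_span_eq_top_of_linearIndependent (g : Presented b →ₗ[ℂ] _) _
      (span_chain_letterNat b) <| linearIndependent_of_hasLeadingUnit fun q => by
        change HasLeadingUnit (g (chain (letterNat b) q.1.1 q.1.2)) _ _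
        rw [map_chain]
        simp only [hg]
        exact hasLeadingUnit_chain (hasLeadingUnit_u b) _ _
  exact Function.Injective.of_comp (f := (slC n).incl.comp (slb b).incl) hinj

lemma presentedHom_surjective : Function.Surjective (presentedHom b) := by
  rintro ⟨a, ha⟩
  induction ha using LieSubalgebra.lieSpan_induction with
  | mem a h =>
    obtain ⟨i, h1, h2, rfl⟩ := h
    exact ⟨letter b ⟨i, h1, h2⟩, presentedHom_letter b ⟨i, h1, h2⟩⟩
  | zero => exact ⟨0, map_zero _⟩
  | add a a' _ _ h h' =>
    obtain ⟨⟨s, hs⟩, ⟨s', hs'⟩⟩ := And.intro h h'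
    exact ⟨s + s', by rw [map_add, hs, hs']; rfl⟩
  | smul t a _ h =>
    obtain ⟨s, hs⟩ := h
    exact ⟨t • s, by rw [map_smul, hs]; rfl⟩
  | lie a a' _ _ h h' =>
    obtain ⟨⟨s, hs⟩, ⟨s', hs'⟩⟩ := And.intro h h'
    exact ⟨⁅s, s'⁆, by rw [LieHom.map_lie, hs, hs']; rfl⟩

end Presentation

end EdgeElectrical

/-- `sl_n^(b)` is presented by its generators `u_i` with the given relations: the assignment
`x_i ↦ u_i` induces an isomorphism from the presented Lie algebra. -/
theorem mainTheorem4 (n : ℕ) (hn : 2 ≤ n) (b : Fin (n - 2) → ℂ) :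
    ∃ φ : EdgeElectrical.Presented b ≃ₗ⁅ℂ⁆ EdgeElectrical.slb b,
      ∀ i : EdgeElectrical.Idx n, φ (EdgeElectrical.letter b i) = EdgeElectrical.gen b i :=
  ⟨LieEquiv.ofBijective (EdgeElectrical.presentedHom b)
    ⟨EdgeElectrical.presentedHom_injective b, EdgeElectrical.presentedHom_surjective b⟩,
    fun i => EdgeElectrical.presentedHom_letter b i⟩
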